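/- All maps are smooth. Let $F\colon U\to\mathbb R^{n+1}$ be an immersion of an open set $U\subset\mathbb R^n$. An affine (Blaschke) normal of $F$ is a transversal vector field $\xi$ along $F$ such that, writing $D_XY=\nabla_XY+h(X,Y)\xi$, all derivatives $D_X\xi$ are tangential, $D_X\xi=-SX$, and $|\det(F_{1},\dots,F_{n},\xi)|=\sqrt{|\det (h_{ij})|}$ in the coordinates of $U$ (so $h$ is nondegenerate). Here $h$ is the affine metric, $S$ the affine shape operator, and $K(X,Y)=\nabla_XY-\widehat\nabla_XY$ the difference tensor, where $\widehat\nabla$ is the Levi-Civita connection of $h$. $F$ is a positive definite affine hypersurface with affine normal $\xi$ if $h$ is positive definite, and an improper affine sphere if $S=0$. For a topological group $G$, $F$ admits a pointwise $G$-symmetry if for every point $p$ there is a subgroup of the group of orientation-preserving linear automorphisms of $T_pU$ that is the image of $G$ under an injective continuous homomorphism and preserves $h$, $K$ and $S$ at $p$, i.e. $h(gX,gY)=h(X,Y)$, $K(gX,gY)=gK(X,Y)$ and $S(gX)=g(SX)$ for all its elements $g$. **Theorem.** Let $N\subset\mathbb R^2$ be open and let $\psi\colon N\to\mathbb R^3$,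 $(u,v)\mapsto(u,v,f(u,v))$, be an improper affine sphere with affine normal $(0,0,1)$. Let $I\subset\mathbb R$ be an open interval and $\gamma=(\gamma_1,\gamma_2)\colon I\to\mathbb R^2$ a curve such that $$F\colon I\times N\to\mathbb R^4,\qquad F(t,u,v)=(u,\,v,\,f(u,v)+\gamma_2(t),\,\gamma_1(t))$$ is a positive definite affine hypersurface with affine normal $\xi$. Then $F$ admits a pointwise $\mathbb Z_3$-symmetry or a pointwise $SO(2)$-symmetry. -/

import Mathlib

open scoped ContDiff

namespace AffineHypersurface

noncomputable section

/-! A hypersurface is given by a parametrization `F`, defined on an open subset `U` of `ℝⁿ`, with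
values in `ℝⁿ⁺¹`. The tangent space at `p` is identified with `ℝⁿ` through the differential of `F`;
tensors are evaluated on tangent vectors `X Y : Fin n → ℝ`, which are extended as constant
(coordinate) vector fields wherever a derivative is taken. -/

variable {n : ℕ}

/-- The linear map `(X, c) ↦ dF_p X + c ξ_p`. -/
def frameMap (F ξ : (Fin n → ℝ) → (Fin (n + 1) → ℝ)) (p : Fin n → ℝ) :
    ((Fin n → ℝ) × ℝ) →L[ℝ] (Fin (n + 1) → ℝ) :=
  (fderiv ℝ F p).coprod (ContinuousLinearMap.toSpanSingleton ℝ (ξ p))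

/-- The tangential part `X` in the decomposition `w = dF_p X + c ξ_p`. -/
def tangentialPart (F ξ : (Fin n → ℝ) → (Fin (n + 1) → ℝ)) (p : Fin n → ℝ)
    (w : Fin (n + 1) → ℝ) : Fin n → ℝ :=
  ((frameMap F ξ p).inverse w).1

/-- The transversal coefficient `c` in the decomposition `w = dF_p X + c ξ_p`. -/
def transversalPart (F ξ : (Fin n → ℝ) → (Fin (n + 1) → ℝ)) (p : Fin n → ℝ)
    (w : Fin (n + 1) → ℝ) : ℝ :=
  ((frameMap F ξ p).inverse w).2

/-- The second derivative `D_X (dF Y)` at `p`, for a constant vector field `Y`. -/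
def secondDeriv (F : (Fin n → ℝ) → (Fin (n + 1) → ℝ)) (p X Y : Fin n → ℝ) : Fin (n + 1) → ℝ :=
  fderiv ℝ (fun q => fderiv ℝ F q Y) p X

/-- The induced bilinear form `h`: the `ξ`-coefficient of `D_X Y = ∇_X Y + h(X, Y) ξ`. -/
def affineMetric (F ξ : (Fin n → ℝ) → (Fin (n + 1) → ℝ)) (p X Y : Fin n → ℝ) : ℝ :=
  transversalPart F ξ p (secondDeriv F p X Y)

/-- The induced connection: `∇_X Y` at `p` for constant vector fields `X`, `Y`, i.e. the
tangential part of `D_X Y = ∇_X Y + h(X, Y) ξ`. -/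
def inducedConnection (F ξ : (Fin n → ℝ) → (Fin (n + 1) → ℝ)) (p X Y : Fin n → ℝ) : Fin n → ℝ :=
  tangentialPart F ξ p (secondDeriv F p X Y)

/-- The shape operator `S`, given by `D_X ξ = - S X` (plus a multiple of `ξ`, which vanishes when
`ξ` is the affine normal). -/
def shapeOperator (F ξ : (Fin n → ℝ) → (Fin (n + 1) → ℝ)) (p X : Fin n → ℝ) : Fin n → ℝ :=
  -tangentialPart F ξ p (fderiv ℝ ξ p X)

/-- The matrix of `h` at `p` in the coordinate basis. -/
def metricMatrix (F ξ : (Fin n → ℝ) → (Fin (n + 1) → ℝ)) (p : Fin n → ℝ) :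
    Matrix (Fin n) (Fin n) ℝ :=
  Matrix.of fun i j => affineMetric F ξ p (Pi.single i 1) (Pi.single j 1)

/-- The Levi-Civita connection of `h`: `∇̂_X Y` at `p` for constant vector fields `X`, `Y`, by the
Koszul formula `2 h(∇̂_X Y, Z) = X h(Y, Z) + Y h(X, Z) - Z h(X, Y)`. -/
def leviCivita (F ξ : (Fin n → ℝ) → (Fin (n + 1) → ℝ)) (p X Y : Fin n → ℝ) : Fin n → ℝ :=
  (metricMatrix F ξ p)⁻¹.mulVec fun l =>
    (1 / 2 : ℝ) *
      (fderiv ℝ (fun q => affineMetric F ξ q Y (Pi.single l 1)) p X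
        + fderiv ℝ (fun q => affineMetric F ξ q X (Pi.single l 1)) p Y
        - fderiv ℝ (fun q => affineMetric F ξ q X Y) p (Pi.single l 1))

/-- The difference tensor `K(X, Y) = ∇_X Y - ∇̂_X Y`. -/
def differenceTensor (F ξ : (Fin n → ℝ) → (Fin (n + 1) → ℝ)) (p X Y : Fin n → ℝ) : Fin n → ℝ :=
  inducedConnection F ξ p X Y - leviCivita F ξ p X Y

/-- The induced volume `det(F_1, …, F_n, ξ)` of the coordinate frame at `p`. -/
def inducedVolume (F ξ : (Fin n → ℝ) → (Fin (n + 1) → ℝ)) (p : Fin n → ℝ) : ℝ :=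
  Matrix.det (Matrix.of
    (Fin.snoc (α := fun _ => Fin (n + 1) → ℝ) (fun i => fderiv ℝ F p (Pi.single i 1)) (ξ p)))

/-- `F` is a nondegenerate hypersurface immersion on `U` with affine (Blaschke) normal field `ξ`:
`ξ` is transversal, its derivatives are tangential, and the induced volume is, up to orientation,
the volume of the metric `h`. The last condition forces `h` to be nondegenerate. -/
structure IsAffineNormal (F ξ : (Fin n → ℝ) → (Fin (n + 1) → ℝ)) (U : Set (Fin n → ℝ)) :
    Prop where
  contDiffOn_immersion : ContDiffOn ℝ ∞ F U
  contDiffOn_normal : ContDiffOn ℝ ∞ ξ U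
  /-- The tangent space and `ξ` span; in particular `F` is an immersion. -/
  transversal : ∀ p ∈ U, (frameMap F ξ p).IsInvertible
  equiaffine : ∀ p ∈ U, ∀ X, transversalPart F ξ p (fderiv ℝ ξ p X) = 0
  volume_eq : ∀ p ∈ U, |inducedVolume F ξ p| = √|(metricMatrix F ξ p).det|

/-- `F` is, on `U`, a positive definite affine hypersurface with affine normal `ξ`. -/
structure IsPositiveDefinite (F ξ : (Fin n → ℝ) → (Fin (n + 1) → ℝ)) (U : Set (Fin n → ℝ)) :
    Prop extends IsAffineNormal F ξ U where
  posDef : ∀ p ∈ U, ∀ X, X ≠ 0 → 0 < affineMetric F ξ p X X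

/-- `F` is, on `U`, an improper affine sphere with affine normal `ξ`: its shape operator
vanishes. -/
structure IsImproperAffineSphere (F ξ : (Fin n → ℝ) → (Fin (n + 1) → ℝ))
    (U : Set (Fin n → ℝ)) : Prop extends IsAffineNormal F ξ U where
  shape_eq_zero : ∀ p ∈ U, ∀ X, shapeOperator F ξ p X = 0

/-- The hypersurface `F` with affine normal `ξ` admits a pointwise `G`-symmetry on `U`: at every
point, a copy of the (topological) group `G` in the orientation-preserving automorphisms of the
tangent space preserves `h`, `K` and `S`. -/
def AdmitsPointwiseSymmetry (G : Type*) [Group G] [TopologicalSpace G]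
    (F ξ : (Fin n → ℝ) → (Fin (n + 1) → ℝ)) (U : Set (Fin n → ℝ)) : Prop :=
  ∀ p ∈ U, ∃ ρ : G →* Matrix.GeneralLinearGroup (Fin n) ℝ,
    Continuous ρ ∧ Function.Injective ρ ∧
    ∀ g : G, let A : Matrix (Fin n) (Fin n) ℝ := (ρ g).val
      0 < A.det ∧
      (∀ X Y, affineMetric F ξ p (A.mulVec X) (A.mulVec Y) = affineMetric F ξ p X Y) ∧
      (∀ X Y, differenceTensor F ξ p (A.mulVec X) (A.mulVec Y)
        = A.mulVec (differenceTensor F ξ p X Y)) ∧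
      (∀ X, shapeOperator F ξ p (A.mulVec X) = A.mulVec (shapeOperator F ξ p X))

/-- The cyclic group of order three. -/
abbrev Z3 : Type := Multiplicative (ZMod 3)

/-- The rotation group of the plane. -/
abbrev SO2 : Type := Matrix.specialOrthogonalGroup (Fin 2) ℝ

end

end AffineHypersurface

/-! The `Z3` alternative holds at every point: the symmetry is the rotation by 2π/3 in the (u,
v)-directions, taken with respect to Hess f and fixing ∂_t.

The improper sphere condition says |det Hess f| = 1, and positive definiteness of F makes it det
Hess f = 1. Let ν be the `conormal`, W the `wronskian` and μ = ν(ξ). Applying ν to the second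
derivatives of F gives h = (W/μ) dt² + (γ₁'/μ) Hess f. The volume condition becomes |μ|⁵ = |W γ₁'²|,
so μ depends on t alone. Since Dξ is tangential, dμ = (dν)(ξ). Its vanishing in the u- and
v-directions puts ξ in the plane of the last two axes, and μ, μ' then determine ξ as a function of t
(`normal_base_eq_zero`, `normal_congr`).

Hence ∇_X Y and SX are multiples of ∂_t and the rotation respects them. The Levi-Civita connection
involves in addition the third derivatives of f. Differentiating det Hess f = 1 makes this cubic
form apolar to Hess f (`exists_cubic`), and a binary cubic apolar to a definite quadratic form is
invariant under rotation by 2π/3 (`cubicForm_rotThird`). -/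

open scoped Topology

namespace AffineHypersurface

/-! ### Linear algebra: groups of order three and equivariance of the Koszul formula. -/

/-- An automorphism of order three preserving `h`, `K` and `S` at `p` generates a copy of `Z3`. -/
theorem exists_Z3_hom {n : ℕ} (F ξ : (Fin n → ℝ) → (Fin (n + 1) → ℝ)) (p : Fin n → ℝ)
    (A : Matrix (Fin n) (Fin n) ℝ) (h3 : A ^ 3 = 1) (h1 : A ≠ 1)
    (hh : ∀ X Y, affineMetric F ξ p (A.mulVec X) (A.mulVec Y) = affineMetric F ξ p X Y)
    (hK : ∀ X Y, differenceTensor F ξ p (A.mulVec X) (A.mulVec Y)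
      = A.mulVec (differenceTensor F ξ p X Y))
    (hS : ∀ X, shapeOperator F ξ p (A.mulVec X) = A.mulVec (shapeOperator F ξ p X)) :
    ∃ ρ : Z3 →* Matrix.GeneralLinearGroup (Fin n) ℝ,
      Continuous ρ ∧ Function.Injective ρ ∧
      ∀ g : Z3, let B : Matrix (Fin n) (Fin n) ℝ := (ρ g).val
        0 < B.det ∧
        (∀ X Y, affineMetric F ξ p (B.mulVec X) (B.mulVec Y) = affineMetric F ξ p X Y) ∧
        (∀ X Y, differenceTensor F ξ p (B.mulVec X) (B.mulVec Y)
          = B.mulVec (differenceTensor F ξ p X Y)) ∧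
        (∀ X, shapeOperator F ξ p (B.mulVec X) = B.mulVec (shapeOperator F ξ p X)) := by
  -- The determinant is a real cube root of unity.
  have hdet : A.det = 1 := by
    have h : A.det ^ 3 = 1 := by rw [← Matrix.det_pow, h3, Matrix.det_one]
    exact (pow_eq_one_iff_of_ne_zero (by norm_num)).1 h |>.resolve_right
      (fun h' => by norm_num [h'.1] at h)
  let a : Matrix.GeneralLinearGroup (Fin n) ℝ :=
    ⟨A, A ^ 2, by rw [← pow_succ', h3], by rw [← pow_succ, h3]⟩
  have ha3 : a ^ 3 = 1 := Units.ext (by simpa [a] using h3)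
  have ha1 : a ≠ 1 := fun h => h1 (by simpa [a] using congrArg Units.val h)
  have hord : orderOf a = 3 := orderOf_eq_prime ha3 ha1
  let φ : ZMod 3 →+ Additive (Matrix.GeneralLinearGroup (Fin n) ℝ) :=
    ZMod.lift 3 ⟨zmultiplesHom _ (Additive.ofMul a), by
      simp only [zmultiplesHom_apply]
      exact congrArg Additive.ofMul (by exact_mod_cast ha3)⟩
  have hφ : ∀ k : ℕ, φ (k : ZMod 3) = Additive.ofMul (a ^ k) := by
    intro k
    have := ZMod.lift_coe 3 (⟨zmultiplesHom _ (Additive.ofMul a), by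
      simp only [zmultiplesHom_apply]
      exact congrArg Additive.ofMul (by exact_mod_cast ha3)⟩ :
        {f : ℤ →+ Additive (Matrix.GeneralLinearGroup (Fin n) ℝ) // f (3 : ℕ) = 0}) (k : ℤ)
    simpa [φ] using this
  refine ⟨AddMonoidHom.toMultiplicativeLeft φ, continuous_of_discreteTopology, ?_, ?_⟩
  · refine (injective_iff_map_eq_one _).2 fun g hg => ?_
    have hk := hφ (ZMod.val (Multiplicative.toAdd g))
    rw [ZMod.natCast_zmod_val] at hk
    have : a ^ ZMod.val (Multiplicative.toAdd g) = 1 := by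
      have h' : φ (Multiplicative.toAdd g) = 0 := hg
      rw [h'] at hk
      exact (congrArg Additive.toMul hk).symm
    have hdvd := orderOf_dvd_of_pow_eq_one this
    rw [hord] at hdvd
    have h0 := Nat.eq_zero_of_dvd_of_lt hdvd (ZMod.val_lt _)
    exact (ZMod.val_eq_zero _).1 h0
  · intro g
    have hk := hφ (ZMod.val (Multiplicative.toAdd g))
    rw [ZMod.natCast_zmod_val] at hk
    have hB : (AddMonoidHom.toMultiplicativeLeft φ g).val
        = A ^ ZMod.val (Multiplicative.toAdd g) := by
      have : AddMonoidHom.toMultiplicativeLeft φ g = a ^ ZMod.val (Multiplicative.toAdd g) :=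
        congrArg Additive.toMul hk
      rw [this]; simp [a]
    intro B
    have hB' : B = A ^ ZMod.val (Multiplicative.toAdd g) := hB
    rw [hB']
    generalize ZMod.val (Multiplicative.toAdd g) = k
    refine ⟨by rw [Matrix.det_pow, hdet, one_pow]; exact one_pos, ?_, ?_, ?_⟩
    · induction k with
      | zero => simp
      | succ k ih => intro X Y; simp only [pow_succ', ← Matrix.mulVec_mulVec, hh, ih]
    · induction k with
      | zero => simp
      | succ k ih => intro X Y; simp only [pow_succ', ← Matrix.mulVec_mulVec, hK, ih]
    · induction k with
      | zero => simp
      | succ k ih => intro X; simp only [pow_succ', ← Matrix.mulVec_mulVec, hS, ih]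

/-- The Levi-Civita connection is equivariant under a linear map preserving the metric and the
right-hand side of the Koszul formula. -/
theorem leviCivita_mulVec {n : ℕ} (F ξ : (Fin n → ℝ) → (Fin (n + 1) → ℝ)) (p : Fin n → ℝ)
    (A : Matrix (Fin n) (Fin n) ℝ) (hA : IsUnit A.det) (hM : IsUnit (metricMatrix F ξ p).det)
    (T : (Fin n → ℝ) → (Fin n → ℝ) → (Fin n → ℝ) → ℝ)
    (hlin : ∀ X Y Z, T X Y Z = ∑ l, Z l * T X Y (Pi.single l 1))
    (hT : ∀ X Y l, (1 / 2 : ℝ) *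
      (fderiv ℝ (fun q => affineMetric F ξ q Y (Pi.single l 1)) p X
        + fderiv ℝ (fun q => affineMetric F ξ q X (Pi.single l 1)) p Y
        - fderiv ℝ (fun q => affineMetric F ξ q X Y) p (Pi.single l 1)) = T X Y (Pi.single l 1))
    (hinv : ∀ X Y Z, T (A.mulVec X) (A.mulVec Y) (A.mulVec Z) = T X Y Z)
    (hbil : ∀ X Y, affineMetric F ξ p X Y
      = ∑ i, ∑ j, X i * Y j * affineMetric F ξ p (Pi.single i 1) (Pi.single j 1))
    (hh : ∀ X Y, affineMetric F ξ p (A.mulVec X) (A.mulVec Y) = affineMetric F ξ p X Y)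
    (X Y : Fin n → ℝ) :
    leviCivita F ξ p (A.mulVec X) (A.mulVec Y) = A.mulVec (leviCivita F ξ p X Y) := by
  set M := metricMatrix F ξ p with hMdef
  have hAMA : A.transpose * M * A = M := by
    ext i j
    have h1 := hh (Pi.single i 1) (Pi.single j 1)
    rw [hbil, Matrix.mulVec_single_one, Matrix.mulVec_single_one] at h1
    simp only [Matrix.mul_apply, Matrix.transpose_apply, Finset.sum_mul]
    rw [Finset.sum_comm]
    rw [show M i j = affineMetric F ξ p (Pi.single i 1) (Pi.single j 1) from rfl, ← h1]
    refine Finset.sum_congr rfl fun k _ => Finset.sum_congr rfl fun l _ => ?_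
    simp only [Matrix.col_apply, hMdef, metricMatrix, Matrix.of_apply]
    ring
  have hTv : A.transpose.mulVec (fun l => T (A.mulVec X) (A.mulVec Y) (Pi.single l 1))
      = fun l => T X Y (Pi.single l 1) := by
    ext l
    rw [← hinv X Y (Pi.single l 1), Matrix.mulVec_single_one, hlin _ _ (A.col l)]
    rfl
  simp only [leviCivita, hT, ← hMdef]
  rw [← hTv, Matrix.mulVec_mulVec, Matrix.mulVec_mulVec]
  congr 1
  have hAt : IsUnit A.transpose.det := by rwa [Matrix.det_transpose]
  -- The claim is A M⁻¹ Aᵀ = M⁻¹, the invariance of the dual metric; it is checked after multiplying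
  -- by the invertible Aᵀ M, where `hAMA` applies.
  have h2 : A.transpose * M * (A * M⁻¹ * A.transpose) = A.transpose * M * M⁻¹ := by
    calc A.transpose * M * (A * M⁻¹ * A.transpose) = (A.transpose * M * A) * M⁻¹ * A.transpose := by
          simp only [Matrix.mul_assoc]
      _ = _ := by
        rw [hAMA, Matrix.mul_nonsing_inv _ hM, Matrix.mul_assoc, Matrix.mul_nonsing_inv _ hM,
          one_mul, mul_one]
  have hu : IsUnit (A.transpose * M) := by
    rw [Matrix.isUnit_iff_isUnit_det, Matrix.det_mul]; exact hAt.mul hM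
  exact (hu.mul_left_cancel h2).symm

/-! ### Hessians and third derivatives of functions of two variables. -/

noncomputable section

/-- The second derivative `X (Y f)` of a function at `x`. -/
def hess {E : Type*} [NormedAddCommGroup E] [NormedSpace ℝ E] (f : E → ℝ) (x X Y : E) : ℝ :=
  fderiv ℝ (fun y => fderiv ℝ f y Y) x X

section Hessian

variable {E : Type*} [NormedAddCommGroup E] [NormedSpace ℝ E] {f : E → ℝ} {N : Set E}

theorem contDiffOn_fderiv_apply (hN : IsOpen N) (hf : ContDiffOn ℝ ∞ f N) (Y : E) :
    ContDiffOn ℝ ∞ (fun y => fderiv ℝ f y Y) N :=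
  (hf.fderiv_of_isOpen hN (by simp)).clm_apply contDiffOn_const

theorem contDiffOn_hess (hN : IsOpen N) (hf : ContDiffOn ℝ ∞ f N) (X Y : E) :
    ContDiffOn ℝ ∞ (fun y => hess f y X Y) N :=
  contDiffOn_fderiv_apply hN (contDiffOn_fderiv_apply hN hf Y) X

theorem _root_.ContDiffOn.differentiableAt_of_isOpen {G : Type*} [NormedAddCommGroup G]
    [NormedSpace ℝ G] {g : E → G} (hf : ContDiffOn ℝ ∞ g N)
    (hN : IsOpen N) {x : E} (hx : x ∈ N) : DifferentiableAt ℝ g x :=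
  (hf.contDiffAt (hN.mem_nhds hx)).differentiableAt (by simp)

theorem hess_eq_fderiv_fderiv (hN : IsOpen N) (hf : ContDiffOn ℝ ∞ f N) {x : E} (hx : x ∈ N)
    (X Y : E) : hess f x X Y = fderiv ℝ (fderiv ℝ f) x X Y := by
  have h : DifferentiableAt ℝ (fderiv ℝ f) x :=
    (hf.fderiv_of_isOpen hN (m := ∞) (by simp)).differentiableAt_of_isOpen hN hx
  simp [hess, fderiv_clm_apply h (differentiableAt_const Y)]

theorem hess_comm (hN : IsOpen N) (hf : ContDiffOn ℝ ∞ f N) {x : E} (hx : x ∈ N) (X Y : E) :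
    hess f x X Y = hess f x Y X := by
  rw [hess_eq_fderiv_fderiv hN hf hx, hess_eq_fderiv_fderiv hN hf hx]
  exact (hf.contDiffAt (hN.mem_nhds hx)).isSymmSndFDerivAt
    (by rw [minSmoothness_of_isRCLikeNormedField]; exact WithTop.coe_le_coe.2 le_top) X Y

end Hessian

theorem map_fin_two (L : (Fin 2 → ℝ) →L[ℝ] ℝ) (X : Fin 2 → ℝ) :
    L X = X 0 * L (Pi.single 0 1) + X 1 * L (Pi.single 1 1) := by
  conv_lhs => rw [← Finset.univ_sum_single X, Fin.sum_univ_two, map_add]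
  have h : ∀ i : Fin 2, L (Pi.single i (X i)) = X i * L (Pi.single i 1) := by
    intro i
    rw [← smul_eq_mul, ← map_smul, ← Pi.single_smul', smul_eq_mul, mul_one]
  rw [h, h]

section Plane

variable {f : (Fin 2 → ℝ) → ℝ} {N : Set (Fin 2 → ℝ)}

/-- The coefficients of the Hessian of a function of two variables. -/
def hessCoeff (f : (Fin 2 → ℝ) → ℝ) (i j : Fin 2) (x : Fin 2 → ℝ) : ℝ :=
  hess f x (Pi.single i 1) (Pi.single j 1)

theorem hess_fin_two (hN : IsOpen N) (hf : ContDiffOn ℝ ∞ f N) {x : Fin 2 → ℝ} (hx : x ∈ N)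
    (X Y : Fin 2 → ℝ) :
    hess f x X Y = hessCoeff f 0 0 x * (X 0 * Y 0) + hessCoeff f 0 1 x * (X 0 * Y 1 + X 1 * Y 0)
      + hessCoeff f 1 1 x * (X 1 * Y 1) := by
  have h := hess_comm hN hf hx (Pi.single 0 1) (Pi.single 1 1)
  simp only [hessCoeff]
  simp only [hess_eq_fderiv_fderiv hN hf hx] at h ⊢
  rw [map_fin_two (fderiv ℝ (fderiv ℝ f) x X) Y]
  have h2 : ∀ Z, fderiv ℝ (fderiv ℝ f) x X Z = X 0 * fderiv ℝ (fderiv ℝ f) x (Pi.single 0 1) Z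
      + X 1 * fderiv ℝ (fderiv ℝ f) x (Pi.single 1 1) Z := fun Z =>
    map_fin_two ((ContinuousLinearMap.apply ℝ ℝ Z).comp (fderiv ℝ (fderiv ℝ f) x)) X
  rw [h2, h2]
  linear_combination X 1 * Y 0 * -h

/-- The third derivatives of a function of two variables whose Hessian determinant is `±1` form a
symmetric cubic form that is apolar to the Hessian. -/
theorem exists_cubic (hN : IsOpen N) (hf : ContDiffOn ℝ ∞ f N)
    (hdet : ∀ x ∈ N, |hessCoeff f 0 0 x * hessCoeff f 1 1 x - hessCoeff f 0 1 x ^ 2| = 1)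
    {x : Fin 2 → ℝ} (hx : x ∈ N) :
    ∃ a b c d : ℝ, (∀ X Y Z, fderiv ℝ (fun y => hess f y Y Z) x X
        = a * (X 0 * Y 0 * Z 0) + b * (X 0 * Y 0 * Z 1 + X 0 * Y 1 * Z 0 + X 1 * Y 0 * Z 0)
          + c * (X 0 * Y 1 * Z 1 + X 1 * Y 0 * Z 1 + X 1 * Y 1 * Z 0) + d * (X 1 * Y 1 * Z 1)) ∧
      a * hessCoeff f 1 1 x - 2 * b * hessCoeff f 0 1 x + c * hessCoeff f 0 0 x = 0 ∧
      b * hessCoeff f 1 1 x - 2 * c * hessCoeff f 0 1 x + d * hessCoeff f 0 0 x = 0 := by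
  have hd : ∀ i j, HasFDerivAt (hessCoeff f i j) (fderiv ℝ (hessCoeff f i j) x) x := fun i j =>
    ((contDiffOn_hess hN hf (Pi.single i 1) (Pi.single j 1)).differentiableAt_of_isOpen hN
      hx).hasFDerivAt
  -- Symmetry of the Hessian of the function ∂_k f.
  have hsym : ∀ i j k : Fin 2, fderiv ℝ (hessCoeff f j k) x (Pi.single i 1)
      = fderiv ℝ (hessCoeff f i k) x (Pi.single j 1) := fun i j k =>
    hess_comm hN (contDiffOn_fderiv_apply hN hf (Pi.single k 1)) hx (Pi.single i 1) (Pi.single j 1)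
  have hcomm : hessCoeff f 1 0 =ᶠ[𝓝 x] hessCoeff f 0 1 := by
    filter_upwards [hN.mem_nhds hx] with y hy using hess_comm hN hf hy _ _
  have h10 := hcomm.fderiv_eq (𝕜 := ℝ)
  have hexp : ∀ X Y Z, fderiv ℝ (fun y => hess f y Y Z) x X
      = fderiv ℝ (hessCoeff f 0 0) x X * (Y 0 * Z 0)
        + fderiv ℝ (hessCoeff f 0 1) x X * (Y 0 * Z 1 + Y 1 * Z 0)
        + fderiv ℝ (hessCoeff f 1 1) x X * (Y 1 * Z 1) := by
    intro X Y Z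
    have he : (fun y => hess f y Y Z) =ᶠ[𝓝 x] fun y => hessCoeff f 0 0 y * (Y 0 * Z 0)
        + hessCoeff f 0 1 y * (Y 0 * Z 1 + Y 1 * Z 0) + hessCoeff f 1 1 y * (Y 1 * Z 1) := by
      filter_upwards [hN.mem_nhds hx] with y hy using hess_fin_two hN hf hy Y Z
    rw [he.fderiv_eq, ((((hd 0 0).mul_const _).fun_add ((hd 0 1).mul_const _)).fun_add
      ((hd 1 1).mul_const _)).fderiv]
    simp [mul_comm]
  -- Apolarity is the derivative of the determinant. Squaring the determinant removes the absolute
  -- value, and the factor it leaves is nonzero.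
  have hsq : ∀ X, fderiv ℝ (hessCoeff f 0 0) x X * hessCoeff f 1 1 x
      - 2 * fderiv ℝ (hessCoeff f 0 1) x X * hessCoeff f 0 1 x
      + fderiv ℝ (hessCoeff f 1 1) x X * hessCoeff f 0 0 x = 0 := by
    intro X
    have hc : (fun y => (hessCoeff f 0 0 y * hessCoeff f 1 1 y
        - hessCoeff f 0 1 y * hessCoeff f 0 1 y) * (hessCoeff f 0 0 y * hessCoeff f 1 1 y
        - hessCoeff f 0 1 y * hessCoeff f 0 1 y)) =ᶠ[𝓝 x] fun _ => (1 : ℝ) := by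
      filter_upwards [hN.mem_nhds hx] with y hy
      have := hdet y hy
      rw [← abs_mul_abs_self, ← pow_two (hessCoeff f 0 1 y), this, one_mul]
    have hD := ((hd 0 0).mul (hd 1 1)).sub ((hd 0 1).mul (hd 0 1))
    have h0 := (hD.mul hD).fderiv
    have h1 := hc.fderiv_eq (𝕜 := ℝ)
    rw [fderiv_fun_const] at h1
    have h2 := DFunLike.congr_fun (h0.symm.trans h1) X
    simp at h2
    have h3 := hdet x hx
    have h4 : hessCoeff f 0 0 x * hessCoeff f 1 1 x - hessCoeff f 0 1 x * hessCoeff f 0 1 x ≠ 0 := by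
      intro h; rw [pow_two, h] at h3; simp at h3
    linear_combination h2.resolve_left h4
  -- The witnesses are f_uuu, f_uuv, f_uvv, f_vvv; the two apolarity relations are `hsq` along u and
  -- along v.
  refine ⟨fderiv ℝ (hessCoeff f 0 0) x (Pi.single 0 1), fderiv ℝ (hessCoeff f 0 1) x (Pi.single 0 1),
    fderiv ℝ (hessCoeff f 1 1) x (Pi.single 0 1), fderiv ℝ (hessCoeff f 1 1) x (Pi.single 1 1),
    ?_, hsq _, ?_⟩
  · intro X Y Z
    rw [hexp, map_fin_two _ X, map_fin_two _ X, map_fin_two _ X]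
    have s1 := hsym 1 0 0
    have s2 := hsym 1 0 1
    rw [h10] at s1
    rw [s1, s2]
    ring
  · have s1 := hsym 1 0 0
    have s2 := hsym 1 0 1
    rw [h10] at s1
    have := hsq (Pi.single 1 1)
    rw [s1, s2] at this
    exact this

end Plane

/-! ### Rotation by 2π/3 and apolar cubic forms. -/

/-- The rotation of `ℝ³` about the first axis by the angle `2π/3` with respect to the quadratic
form `e X₁² + 2 g X₁ X₂ + k X₂²` of determinant one. -/
def rotThird (e g k : ℝ) : Matrix (Fin 3) (Fin 3) ℝ :=
  -- The lower block is -1/2 + (√3/2) J with J = (-g, -k; e, g). When ek - g² = 1, J² = -1 and J is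
  -- skew for the quadratic form, so J is its quarter turn.
  !![1, 0, 0;
     0, -1 / 2 - √3 / 2 * g, -(√3 / 2) * k;
     0, √3 / 2 * e, -1 / 2 + √3 / 2 * g]

section Rotation

variable {e g k : ℝ}

theorem rotThird_mulVec_zero (X : Fin 3 → ℝ) : (rotThird e g k).mulVec X 0 = X 0 := by
  simp [rotThird, Matrix.mulVec, dotProduct, Fin.sum_univ_three]

theorem rotThird_mulVec_one (X : Fin 3 → ℝ) :
    (rotThird e g k).mulVec X 1 = (-1 / 2 - √3 / 2 * g) * X 1 - √3 / 2 * k * X 2 := by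
  simp [rotThird, Matrix.mulVec, dotProduct, Fin.sum_univ_three]
  ring

theorem rotThird_mulVec_two (X : Fin 3 → ℝ) :
    (rotThird e g k).mulVec X 2 = √3 / 2 * e * X 1 + (-1 / 2 + √3 / 2 * g) * X 2 := by
  simp [rotThird, Matrix.mulVec, dotProduct, Fin.sum_univ_three]

theorem rotThird_mulVec_single_zero (c : ℝ) :
    (rotThird e g k).mulVec (Pi.single 0 c) = Pi.single 0 c := by
  ext i
  fin_cases i <;> simp [rotThird, Matrix.mulVec, dotProduct, Fin.sum_univ_three]

theorem rotThird_pow_three (hdet : e * k - g ^ 2 = 1) : rotThird e g k ^ 3 = 1 := by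
  have hs : √3 ^ 2 = 3 := Real.sq_sqrt (by norm_num)
  rw [pow_three, rotThird]
  generalize √3 = s at hs
  ext i j
  fin_cases i <;> fin_cases j <;> simp [Matrix.mul_apply, Fin.sum_univ_three] <;> grind

theorem rotThird_ne_one : rotThird e g k ≠ 1 := by
  intro h
  have h1 := congrFun (congrFun h 1) 1
  have h2 := congrFun (congrFun h 2) 2
  simp [rotThird] at h1 h2
  linarith

theorem rotThird_quadratic (hdet : e * k - g ^ 2 = 1) (X Y : Fin 3 → ℝ) :
    e * ((rotThird e g k).mulVec X 1 * (rotThird e g k).mulVec Y 1)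
      + g * ((rotThird e g k).mulVec X 1 * (rotThird e g k).mulVec Y 2
        + (rotThird e g k).mulVec X 2 * (rotThird e g k).mulVec Y 1)
      + k * ((rotThird e g k).mulVec X 2 * (rotThird e g k).mulVec Y 2)
    = e * (X 1 * Y 1) + g * (X 1 * Y 2 + X 2 * Y 1) + k * (X 2 * Y 2) := by
  have hs : √3 ^ 2 = 3 := Real.sq_sqrt (by norm_num)
  simp only [rotThird_mulVec_one, rotThird_mulVec_two]
  generalize √3 = s at hs
  grind

/-- The symmetric cubic form in the last two coordinates with coefficients `a, b, c, d`. -/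
def cubicForm (a b c d : ℝ) (X Y Z : Fin 3 → ℝ) : ℝ :=
  a * (X 1 * Y 1 * Z 1) + b * (X 1 * Y 1 * Z 2 + X 1 * Y 2 * Z 1 + X 2 * Y 1 * Z 1)
    + c * (X 1 * Y 2 * Z 2 + X 2 * Y 1 * Z 2 + X 2 * Y 2 * Z 1) + d * (X 2 * Y 2 * Z 2)

theorem cubicForm_comm_left (a b c d : ℝ) (X Y Z : Fin 3 → ℝ) :
    cubicForm a b c d X Y Z = cubicForm a b c d Y X Z := by
  simp only [cubicForm]; ring

theorem cubicForm_comm_right (a b c d : ℝ) (X Y Z : Fin 3 → ℝ) :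
    cubicForm a b c d X Y Z = cubicForm a b c d X Z Y := by
  simp only [cubicForm]; ring

/-- The rotation is self-adjoint with respect to an apolar cubic form. -/
theorem cubicForm_rotThird_left {a b c d : ℝ}
    (h₁ : a * k - 2 * b * g + c * e = 0) (h₂ : b * k - 2 * c * g + d * e = 0)
    (X Y Z : Fin 3 → ℝ) :
    cubicForm a b c d ((rotThird e g k).mulVec X) Y Z
      = cubicForm a b c d X ((rotThird e g k).mulVec Y) Z := by
  simp only [cubicForm, rotThird_mulVec_one, rotThird_mulVec_two]
  -- The difference of the two sides is alternating in X, Y, hence a multiple of X₁Y₂ - X₂Y₁; its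
  -- coefficient is the trace of the cubic form, linear in Z.
  linear_combination (√3 / 2) * (X 1 * Y 2 - X 2 * Y 1) * (Z 1 * h₁ + Z 2 * h₂)

/-- Self-adjointness and symmetry move all three rotations onto one argument, where their product is
the identity. -/
theorem cubicForm_rotThird (hdet : e * k - g ^ 2 = 1) {a b c d : ℝ}
    (h₁ : a * k - 2 * b * g + c * e = 0) (h₂ : b * k - 2 * c * g + d * e = 0)
    (X Y Z : Fin 3 → ℝ) :
    cubicForm a b c d ((rotThird e g k).mulVec X) ((rotThird e g k).mulVec Y)
      ((rotThird e g k).mulVec Z) = cubicForm a b c d X Y Z := by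
  have h3 : ∀ V, (rotThird e g k).mulVec ((rotThird e g k).mulVec ((rotThird e g k).mulVec V))
      = V := by
    intro V
    rw [Matrix.mulVec_mulVec, Matrix.mulVec_mulVec, ← pow_three', rotThird_pow_three hdet,
      Matrix.one_mulVec]
  rw [← cubicForm_rotThird_left h₁ h₂, cubicForm_comm_right, ← cubicForm_rotThird_left h₁ h₂, h3,
    cubicForm_comm_right]

end Rotation

/-! ### Tangential and transversal parts. -/

section Decomposition

variable {n : ℕ} {F ξ : (Fin n → ℝ) → (Fin (n + 1) → ℝ)} {p : Fin n → ℝ}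

theorem fderiv_tangentialPart_add (h : (frameMap F ξ p).IsInvertible) (w : Fin (n + 1) → ℝ) :
    fderiv ℝ F p (tangentialPart F ξ p w) + transversalPart F ξ p w • ξ p = w := by
  have := h.self_apply_inverse w
  simpa [frameMap, tangentialPart, transversalPart] using this

theorem transversalPart_of_eq (h : (frameMap F ξ p).IsInvertible) {w : Fin (n + 1) → ℝ}
    {X : Fin n → ℝ} {c : ℝ} (hw : fderiv ℝ F p X + c • ξ p = w) :
    transversalPart F ξ p w = c := by
  have h1 : frameMap F ξ p (X, c) = w := by simpa [frameMap] using hw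
  rw [transversalPart, ← h1, h.inverse_apply_self]

/-- This reads off the transversal coefficient from a conormal form, without inverting the frame. -/
theorem map_eq_transversalPart_mul (h : (frameMap F ξ p).IsInvertible)
    (ν : (Fin (n + 1) → ℝ) →ₗ[ℝ] ℝ) (hν : ∀ X, ν (fderiv ℝ F p X) = 0) (w : Fin (n + 1) → ℝ) :
    ν w = transversalPart F ξ p w * ν (ξ p) := by
  conv_lhs => rw [← fderiv_tangentialPart_add h w, map_add, hν, zero_add, map_smul, smul_eq_mul]

theorem injective_fderiv (h : (frameMap F ξ p).IsInvertible) {X : Fin n → ℝ}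
    (hX : fderiv ℝ F p X = 0) : X = 0 := by
  have h1 : frameMap F ξ p (X, 0) = 0 := by simpa [frameMap] using hX
  have := h.inverse_apply_self (X, (0 : ℝ))
  rw [h1, map_zero] at this
  exact (congrArg Prod.fst this).symm

end Decomposition

/-! ### The Monge–Ampère equation of the base surface. -/

/-- The Hessian determinant of an improper affine sphere that is a graph over the plane. -/
theorem IsImproperAffineSphere.abs_det_hess {N : Set (Fin 2 → ℝ)} (hN : IsOpen N)
    {f : (Fin 2 → ℝ) → ℝ} (hf : ContDiffOn ℝ ∞ f N)
    (hψ : IsImproperAffineSphere (fun x => ![x 0, x 1, f x]) (fun _ => ![0, 0, 1]) N)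
    {x : Fin 2 → ℝ} (hx : x ∈ N) :
    |hessCoeff f 0 0 x * hessCoeff f 1 1 x - hessCoeff f 0 1 x ^ 2| = 1 := by
  have hd : ∀ y ∈ N, ∀ X, fderiv ℝ (fun x : Fin 2 → ℝ => ![x 0, x 1, f x]) y X
      = ![X 0, X 1, fderiv ℝ f y X] := by
    intro y hy X
    have h0 : HasFDerivAt (fun x : Fin 2 → ℝ => ![x 0, x 1, f x])
        (ContinuousLinearMap.pi ![ContinuousLinearMap.proj 0, ContinuousLinearMap.proj 1,
          fderiv ℝ f y]) y := by
      rw [hasFDerivAt_pi']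
      intro i
      fin_cases i
      · exact hasFDerivAt_apply 0 y
      · exact hasFDerivAt_apply 1 y
      · exact (hf.differentiableAt_of_isOpen hN hy).hasFDerivAt
    rw [h0.fderiv]
    ext i
    fin_cases i <;> rfl
  have hdd : ∀ X Y, secondDeriv (fun x : Fin 2 → ℝ => ![x 0, x 1, f x]) x X Y
      = ![0, 0, hess f x X Y] := by
    intro X Y
    have he : (fun q => fderiv ℝ (fun x : Fin 2 → ℝ => ![x 0, x 1, f x]) q Y) =ᶠ[𝓝 x]
        fun q => ![Y 0, Y 1, fderiv ℝ f q Y] := by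
      filter_upwards [hN.mem_nhds hx] with y hy using hd y hy Y
    have h0 : HasFDerivAt (fun q => ![Y 0, Y 1, fderiv ℝ f q Y])
        (ContinuousLinearMap.pi ![0, 0, fderiv ℝ (fun q => fderiv ℝ f q Y) x]) x := by
      rw [hasFDerivAt_pi']
      intro i
      fin_cases i
      · exact hasFDerivAt_const _ _
      · exact hasFDerivAt_const _ _
      · exact ((contDiffOn_fderiv_apply hN hf Y).differentiableAt_of_isOpen hN hx).hasFDerivAt
    rw [secondDeriv, he.fderiv_eq, h0.fderiv]
    ext i
    fin_cases i <;> rfl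
  -- The second derivatives of the graph are already multiples of (0, 0, 1), so h = Hess f; the
  -- induced volume below is 1.
  have hm : ∀ X Y, affineMetric (fun x : Fin 2 → ℝ => ![x 0, x 1, f x]) (fun _ => ![0, 0, 1]) x X Y
      = hess f x X Y := by
    intro X Y
    refine transversalPart_of_eq (hψ.transversal x hx) (X := 0) ?_
    rw [hdd]
    ext i
    fin_cases i <;> simp
  have hvol := hψ.volume_eq x hx
  have h10 := hess_comm hN hf hx (Pi.single 1 1) (Pi.single 0 1)
  rw [Matrix.det_fin_two] at hvol
  simp only [metricMatrix, Matrix.of_apply, hm, h10] at hvol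
  have hv : |inducedVolume (fun x : Fin 2 → ℝ => ![x 0, x 1, f x]) (fun _ => ![0, 0, 1]) x| = 1 := by
    have hmat : inducedVolume (fun x : Fin 2 → ℝ => ![x 0, x 1, f x]) (fun _ => ![0, 0, 1]) x
        = Matrix.det !![1, 0, fderiv ℝ f x (Pi.single 0 1); 0, 1, fderiv ℝ f x (Pi.single 1 1);
          0, 0, 1] := by
      simp only [inducedVolume, hd x hx]
      congr 1
      ext i j
      fin_cases i <;> fin_cases j <;> simp [Fin.snoc]
    rw [hmat, Matrix.det_fin_three]
    simp
  rw [hv] at hvol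
  have := (Real.sqrt_eq_one).1 hvol.symm
  rw [pow_two]
  exact this

/-! ### The hypersurface, and functions of t alone. -/

/-- The projection `(t, u, v) ↦ (u, v)`. -/
def baseProj : (Fin 3 → ℝ) →L[ℝ] (Fin 2 → ℝ) :=
  ContinuousLinearMap.pi ![ContinuousLinearMap.proj 1, ContinuousLinearMap.proj 2]

theorem baseProj_apply (p : Fin 3 → ℝ) : baseProj p = ![p 1, p 2] := by
  ext i; fin_cases i <;> rfl

@[simp] theorem baseProj_zero (p : Fin 3 → ℝ) : baseProj p 0 = p 1 := rfl

@[simp] theorem baseProj_one (p : Fin 3 → ℝ) : baseProj p 1 = p 2 := rfl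

/-- The immersion `(t, u, v) ↦ (u, v, f(u, v) + γ₂(t), γ₁(t))`. -/
def translationImmersion (f : (Fin 2 → ℝ) → ℝ) (γ : ℝ → Fin 2 → ℝ) (p : Fin 3 → ℝ) : Fin 4 → ℝ :=
  ![p 1, p 2, f (baseProj p) + γ (p 0) 1, γ (p 0) 0]

/-- The domain `I × N`. -/
def translationDomain (I : Set ℝ) (N : Set (Fin 2 → ℝ)) : Set (Fin 3 → ℝ) :=
  {p | p 0 ∈ I ∧ baseProj p ∈ N}

theorem isOpen_translationDomain {I : Set ℝ} {N : Set (Fin 2 → ℝ)} (hI : IsOpen I)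
    (hN : IsOpen N) : IsOpen (translationDomain I N) :=
  (hI.preimage (continuous_apply 0)).inter (hN.preimage baseProj.continuous)

section FirstCoordinate

variable {V : Type*} [NormedAddCommGroup V] [NormedSpace ℝ V] {U : Set (Fin 3 → ℝ)}
  {g : (Fin 3 → ℝ) → V}

theorem fderiv_of_eq_of_first_eq (hU : IsOpen U)
    (hg : ∀ q ∈ U, ∀ q' ∈ U, q 0 = q' 0 → g q = g q') {p : Fin 3 → ℝ} (hp : p ∈ U)
    (hd : DifferentiableAt ℝ g p) (X : Fin 3 → ℝ) :
    fderiv ℝ g p X = X 0 • fderiv ℝ g p (Pi.single 0 1) := by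
  have key : ∀ Y : Fin 3 → ℝ, Y 0 = 0 → fderiv ℝ g p Y = 0 := by
    intro Y hY
    have h1 := hd.hasFDerivAt.hasLineDerivAt Y
    have hcont : Filter.Tendsto (fun t : ℝ => p + t • Y) (𝓝 0) (𝓝 p) := by
      have : Continuous (fun t : ℝ => p + t • Y) := by fun_prop
      simpa using this.tendsto 0
    have h2 : (fun t : ℝ => g (p + t • Y)) =ᶠ[𝓝 0] fun _ => g p := by
      filter_upwards [hcont.eventually (hU.mem_nhds hp)] with t ht
      exact hg _ ht _ hp (by simp [hY])
    have h3 : HasDerivAt (fun t : ℝ => g (p + t • Y)) (fderiv ℝ g p Y) 0 := h1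
    exact h3.unique ((hasDerivAt_const (0 : ℝ) (g p)).congr_of_eventuallyEq h2)
  have h := key (X - X 0 • Pi.single 0 1) (by simp)
  rw [map_sub, map_smul, sub_eq_zero] at h
  exact h

/-- The t-derivative of a function of t alone again depends on t alone. Comparing two points
directly allows slices t = const that are not connected. -/
theorem fderiv_first_congr (hU : IsOpen U)
    (hg : ∀ q ∈ U, ∀ q' ∈ U, q 0 = q' 0 → g q = g q') {p p' : Fin 3 → ℝ} (hp : p ∈ U)
    (hp' : p' ∈ U) (h0 : p 0 = p' 0)
    (hd : DifferentiableAt ℝ g p) (hd' : DifferentiableAt ℝ g p') :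
    fderiv ℝ g p (Pi.single 0 1) = fderiv ℝ g p' (Pi.single 0 1) := by
  have hcont : ∀ p : Fin 3 → ℝ, Filter.Tendsto
      (fun t : ℝ => p + t • (Pi.single 0 1 : Fin 3 → ℝ)) (𝓝 0) (𝓝 p) := by
    intro p
    have : Continuous (fun t : ℝ => p + t • (Pi.single 0 1 : Fin 3 → ℝ)) := by fun_prop
    simpa using this.tendsto 0
  have h1 : HasDerivAt (fun t : ℝ => g (p + t • (Pi.single 0 1 : Fin 3 → ℝ))) _ 0 :=
    hd.hasFDerivAt.hasLineDerivAt (Pi.single 0 1)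
  have h2 : HasDerivAt (fun t : ℝ => g (p' + t • (Pi.single 0 1 : Fin 3 → ℝ))) _ 0 :=
    hd'.hasFDerivAt.hasLineDerivAt (Pi.single 0 1)
  refine h1.unique (h2.congr_of_eventuallyEq ?_)
  filter_upwards [(hcont p).eventually (hU.mem_nhds hp),
    (hcont p').eventually (hU.mem_nhds hp')] with t ht ht'
  exact hg _ ht _ ht' (by simp [h0])

end FirstCoordinate

/-- The data of the hypersurface `(t, u, v) ↦ (u, v, f(u, v) + γ₂(t), γ₁(t))` over a graph with
Hessian determinant `±1`. -/
structure IsTranslationHypersurface (N : Set (Fin 2 → ℝ)) (f : (Fin 2 → ℝ) → ℝ) (I : Set ℝ)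
    (γ : ℝ → Fin 2 → ℝ) (ξ : (Fin 3 → ℝ) → (Fin 4 → ℝ)) : Prop where
  isOpen_base : IsOpen N
  contDiffOn_graph : ContDiffOn ℝ ∞ f N
  abs_det : ∀ x ∈ N, |hessCoeff f 0 0 x * hessCoeff f 1 1 x - hessCoeff f 0 1 x ^ 2| = 1
  isOpen_interval : IsOpen I
  contDiffOn_curve : ContDiffOn ℝ ∞ γ I
  posDef : IsPositiveDefinite (translationImmersion f γ) ξ (translationDomain I N)

/-- The derivative of the `i`-th component of a plane curve. -/
def vel (γ : ℝ → Fin 2 → ℝ) (i : Fin 2) (t : ℝ) : ℝ := deriv (fun s => γ s i) t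

/-- The second derivative of the `i`-th component of a plane curve. -/
def acc (γ : ℝ → Fin 2 → ℝ) (i : Fin 2) (t : ℝ) : ℝ := deriv (vel γ i) t

/-- The determinant of velocity and acceleration. -/
def wronskian (γ : ℝ → Fin 2 → ℝ) (t : ℝ) : ℝ := vel γ 0 t * acc γ 1 t - vel γ 1 t * acc γ 0 t

/-- A linear form that annihilates the tangent space of the hypersurface. -/
def conormal (f : (Fin 2 → ℝ) → ℝ) (γ : ℝ → Fin 2 → ℝ) (q : Fin 3 → ℝ) : (Fin 4 → ℝ) →ₗ[ℝ] ℝ :=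
  vel γ 0 (q 0) • (LinearMap.proj 2 - (fderiv ℝ f (baseProj q) (Pi.single 0 1) • LinearMap.proj 0
    + fderiv ℝ f (baseProj q) (Pi.single 1 1) • LinearMap.proj 1))
    - vel γ 1 (q 0) • LinearMap.proj 3

theorem conormal_apply (f : (Fin 2 → ℝ) → ℝ) (γ : ℝ → Fin 2 → ℝ) (q : Fin 3 → ℝ)
    (w : Fin 4 → ℝ) : conormal f γ q w = vel γ 0 (q 0) * (w 2
      - (fderiv ℝ f (baseProj q) (Pi.single 0 1) * w 0
        + fderiv ℝ f (baseProj q) (Pi.single 1 1) * w 1)) - vel γ 1 (q 0) * w 3 := by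
  simp [conormal]

/-! ### Derivatives, affine metric and volume of the hypersurface. -/

namespace IsTranslationHypersurface

variable {N : Set (Fin 2 → ℝ)} {f : (Fin 2 → ℝ) → ℝ} {I : Set ℝ} {γ : ℝ → Fin 2 → ℝ}
  {ξ : (Fin 3 → ℝ) → (Fin 4 → ℝ)} {q : Fin 3 → ℝ}

theorem isOpen_domain (H : IsTranslationHypersurface N f I γ ξ) :
    IsOpen (translationDomain I N) :=
  isOpen_translationDomain H.isOpen_interval H.isOpen_base

theorem contDiffOn_component (H : IsTranslationHypersurface N f I γ ξ) (i : Fin 2) :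
    ContDiffOn ℝ ∞ (fun s => γ s i) I :=
  contDiffOn_pi.1 H.contDiffOn_curve i

theorem contDiffOn_vel (H : IsTranslationHypersurface N f I γ ξ) (i : Fin 2) :
    ContDiffOn ℝ ∞ (vel γ i) I :=
  (H.contDiffOn_component i).deriv_of_isOpen H.isOpen_interval (by simp)

theorem contDiffOn_acc (H : IsTranslationHypersurface N f I γ ξ) (i : Fin 2) :
    ContDiffOn ℝ ∞ (acc γ i) I :=
  (H.contDiffOn_vel i).deriv_of_isOpen H.isOpen_interval (by simp)

theorem hasFDerivAt_comp_first {g : ℝ → ℝ} (hI : IsOpen I) (hg : ContDiffOn ℝ ∞ g I)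
    (hq : q 0 ∈ I) : HasFDerivAt (fun p : Fin 3 → ℝ => g (p 0))
      (deriv g (q 0) • (ContinuousLinearMap.proj 0 : (Fin 3 → ℝ) →L[ℝ] ℝ)) q :=
  (hg.differentiableAt_of_isOpen hI hq).hasDerivAt.comp_hasFDerivAt q (hasFDerivAt_apply 0 q)

theorem hasFDerivAt_comp_baseProj {g : (Fin 2 → ℝ) → ℝ} (hN : IsOpen N)
    (hg : ContDiffOn ℝ ∞ g N) (hq : baseProj q ∈ N) :
    HasFDerivAt (fun p : Fin 3 → ℝ => g (baseProj p))
      ((fderiv ℝ g (baseProj q)).comp baseProj) q :=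
  (hg.differentiableAt_of_isOpen hN hq).hasFDerivAt.comp q baseProj.hasFDerivAt

theorem fderiv_immersion (H : IsTranslationHypersurface N f I γ ξ)
    (hq : q ∈ translationDomain I N) (X : Fin 3 → ℝ) :
    fderiv ℝ (translationImmersion f γ) q X = ![X 1, X 2,
      fderiv ℝ f (baseProj q) (baseProj X) + X 0 * vel γ 1 (q 0), X 0 * vel γ 0 (q 0)] := by
  have h0 : HasFDerivAt (translationImmersion f γ)
      (ContinuousLinearMap.pi ![ContinuousLinearMap.proj 1, ContinuousLinearMap.proj 2,
        (fderiv ℝ f (baseProj q)).comp baseProj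
          + vel γ 1 (q 0) • (ContinuousLinearMap.proj 0 : (Fin 3 → ℝ) →L[ℝ] ℝ),
        vel γ 0 (q 0) • (ContinuousLinearMap.proj 0 : (Fin 3 → ℝ) →L[ℝ] ℝ)]) q := by
    rw [hasFDerivAt_pi']
    intro i
    fin_cases i
    · exact hasFDerivAt_apply 1 q
    · exact hasFDerivAt_apply 2 q
    · exact (hasFDerivAt_comp_baseProj H.isOpen_base H.contDiffOn_graph hq.2).add
        (hasFDerivAt_comp_first H.isOpen_interval (H.contDiffOn_component 1) hq.1)
    · exact hasFDerivAt_comp_first H.isOpen_interval (H.contDiffOn_component 0) hq.1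
  rw [h0.fderiv]
  ext i
  fin_cases i <;> simp [mul_comm]

theorem secondDeriv_immersion (H : IsTranslationHypersurface N f I γ ξ)
    (hq : q ∈ translationDomain I N) (X Y : Fin 3 → ℝ) :
    secondDeriv (translationImmersion f γ) q X Y = ![0, 0,
      hess f (baseProj q) (baseProj X) (baseProj Y) + X 0 * Y 0 * acc γ 1 (q 0),
      X 0 * Y 0 * acc γ 0 (q 0)] := by
  have he : (fun p => fderiv ℝ (translationImmersion f γ) p Y) =ᶠ[𝓝 q] fun p => ![Y 1, Y 2,
      fderiv ℝ f (baseProj p) (baseProj Y) + Y 0 * vel γ 1 (p 0), Y 0 * vel γ 0 (p 0)] := by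
    filter_upwards [H.isOpen_domain.mem_nhds hq] with p hp using H.fderiv_immersion hp Y
  have h0 : HasFDerivAt (fun p : Fin 3 → ℝ => ![Y 1, Y 2,
      fderiv ℝ f (baseProj p) (baseProj Y) + Y 0 * vel γ 1 (p 0), Y 0 * vel γ 0 (p 0)])
      (ContinuousLinearMap.pi ![0, 0,
        (fderiv ℝ (fun x => fderiv ℝ f x (baseProj Y)) (baseProj q)).comp baseProj
          + Y 0 • acc γ 1 (q 0) • (ContinuousLinearMap.proj 0 : (Fin 3 → ℝ) →L[ℝ] ℝ),
        Y 0 • acc γ 0 (q 0) • (ContinuousLinearMap.proj 0 : (Fin 3 → ℝ) →L[ℝ] ℝ)]) q := by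
    rw [hasFDerivAt_pi']
    intro i
    fin_cases i
    · exact hasFDerivAt_const _ _
    · exact hasFDerivAt_const _ _
    · exact (hasFDerivAt_comp_baseProj H.isOpen_base (contDiffOn_fderiv_apply H.isOpen_base
          H.contDiffOn_graph (baseProj Y)) hq.2).add
        ((hasFDerivAt_comp_first H.isOpen_interval (H.contDiffOn_vel 1) hq.1).const_mul (Y 0))
    · exact (hasFDerivAt_comp_first H.isOpen_interval (H.contDiffOn_vel 0) hq.1).const_mul (Y 0)
  rw [secondDeriv, he.fderiv_eq, h0.fderiv]
  ext i
  fin_cases i <;> simp [hess] <;> ring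

theorem conormal_fderiv (H : IsTranslationHypersurface N f I γ ξ)
    (hq : q ∈ translationDomain I N) (X : Fin 3 → ℝ) :
    conormal f γ q (fderiv ℝ (translationImmersion f γ) q X) = 0 := by
  rw [H.fderiv_immersion hq, conormal_apply, map_fin_two]
  simp
  ring

/-- Otherwise the conormal kills tangent space and ξ, so it is zero; this forces γ' = 0, and ∂_t
lies in the kernel of dF. -/
theorem conormal_normal_ne_zero (H : IsTranslationHypersurface N f I γ ξ)
    (hq : q ∈ translationDomain I N) : conormal f γ q (ξ q) ≠ 0 := by
  intro h
  have hz : ∀ w, conormal f γ q w = 0 := fun w => by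
    rw [map_eq_transversalPart_mul (H.posDef.transversal q hq) _ (H.conormal_fderiv hq), h,
      mul_zero]
  have h0 := hz (Pi.single 2 1)
  have h1 := hz (Pi.single 3 1)
  simp [conormal_apply] at h0 h1
  have h2 : (Pi.single 0 1 : Fin 3 → ℝ) = 0 := by
    refine injective_fderiv (H.posDef.transversal q hq) ?_
    rw [H.fderiv_immersion hq, h0, h1, map_fin_two]
    ext i
    fin_cases i <;> simp
  simpa using congrFun h2 0

theorem affineMetric_eq (H : IsTranslationHypersurface N f I γ ξ)
    (hq : q ∈ translationDomain I N) (X Y : Fin 3 → ℝ) :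
    affineMetric (translationImmersion f γ) ξ q X Y
      = wronskian γ (q 0) / conormal f γ q (ξ q) * (X 0 * Y 0)
        + vel γ 0 (q 0) / conormal f γ q (ξ q) * hess f (baseProj q) (baseProj X) (baseProj Y) := by
  have h := map_eq_transversalPart_mul (H.posDef.transversal q hq) _ (H.conormal_fderiv hq)
    (secondDeriv (translationImmersion f γ) q X Y)
  have hne := H.conormal_normal_ne_zero hq
  replace h := (eq_div_iff hne).2 h.symm
  rw [affineMetric, h, H.secondDeriv_immersion hq, conormal_apply]
  simp [wronskian]
  field_simp
  ring

theorem affineMetric_coord (H : IsTranslationHypersurface N f I γ ξ)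
    (hq : q ∈ translationDomain I N) (X Y : Fin 3 → ℝ) :
    affineMetric (translationImmersion f γ) ξ q X Y
      = wronskian γ (q 0) / conormal f γ q (ξ q) * (X 0 * Y 0)
        + vel γ 0 (q 0) / conormal f γ q (ξ q) * (hessCoeff f 0 0 (baseProj q) * (X 1 * Y 1)
          + hessCoeff f 0 1 (baseProj q) * (X 1 * Y 2 + X 2 * Y 1)
          + hessCoeff f 1 1 (baseProj q) * (X 2 * Y 2)) := by
  rw [H.affineMetric_eq hq, hess_fin_two H.isOpen_base H.contDiffOn_graph hq.2]
  rfl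

theorem wronskian_div_pos (H : IsTranslationHypersurface N f I γ ξ)
    (hq : q ∈ translationDomain I N) : 0 < wronskian γ (q 0) / conormal f γ q (ξ q) := by
  have h := H.posDef.posDef q hq (Pi.single 0 1) (by simp)
  rw [H.affineMetric_coord hq] at h
  simpa using h

theorem vel_mul_hessCoeff_pos (H : IsTranslationHypersurface N f I γ ξ)
    (hq : q ∈ translationDomain I N) :
    0 < vel γ 0 (q 0) / conormal f γ q (ξ q) * hessCoeff f 0 0 (baseProj q) := by
  have h := H.posDef.posDef q hq (Pi.single 1 1) (by simp)
  rw [H.affineMetric_coord hq] at h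
  simpa using h

theorem det_hess_eq_one (H : IsTranslationHypersurface N f I γ ξ)
    (hq : q ∈ translationDomain I N) :
    hessCoeff f 0 0 (baseProj q) * hessCoeff f 1 1 (baseProj q)
      - hessCoeff f 0 1 (baseProj q) ^ 2 = 1 := by
  have h1 := H.vel_mul_hessCoeff_pos hq
  have hE : hessCoeff f 0 0 (baseProj q) ≠ 0 := fun h => by simp [h] at h1
  -- The test vector is orthogonal to ∂_u in the (u, v)-plane; Hess f takes on it the value f_uu ·
  -- det Hess f.
  have h := H.posDef.posDef q hq
    ![0, -hessCoeff f 0 1 (baseProj q), hessCoeff f 0 0 (baseProj q)]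
    (fun h => hE (by simpa using congrFun h 2))
  rw [H.affineMetric_coord hq] at h
  simp at h
  have hpos : 0 < hessCoeff f 0 0 (baseProj q) * hessCoeff f 1 1 (baseProj q)
      - hessCoeff f 0 1 (baseProj q) ^ 2 := by
    refine pos_of_mul_pos_right (lt_of_lt_of_eq h ?_) h1.le
    ring
  rw [← abs_of_pos hpos]
  exact H.abs_det _ hq.2

theorem det_metricMatrix (H : IsTranslationHypersurface N f I γ ξ)
    (hq : q ∈ translationDomain I N) :
    (metricMatrix (translationImmersion f γ) ξ q).det
      = wronskian γ (q 0) * vel γ 0 (q 0) ^ 2 / conormal f γ q (ξ q) ^ 3 := by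
  have hd := H.det_hess_eq_one hq
  have hne := H.conormal_normal_ne_zero hq
  rw [Matrix.det_fin_three]
  simp only [metricMatrix, Matrix.of_apply, H.affineMetric_coord hq]
  simp
  field_simp
  linear_combination wronskian γ (q 0) * vel γ 0 (q 0) ^ 2 * hd

theorem inducedVolume_eq (H : IsTranslationHypersurface N f I γ ξ)
    (hq : q ∈ translationDomain I N) :
    |inducedVolume (translationImmersion f γ) ξ q| = |conormal f γ q (ξ q)| := by
  have hmat : inducedVolume (translationImmersion f γ) ξ q
      = Matrix.det !![0, 0, vel γ 1 (q 0), vel γ 0 (q 0);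
        1, 0, fderiv ℝ f (baseProj q) (Pi.single 0 1), 0;
        0, 1, fderiv ℝ f (baseProj q) (Pi.single 1 1), 0;
        ξ q 0, ξ q 1, ξ q 2, ξ q 3] := by
    have h2 : ∀ h, Fin.castPred (2 : Fin 4) h = 2 := fun _ => rfl
    simp only [inducedVolume, H.fderiv_immersion hq, map_fin_two _ (baseProj _)]
    congr 1
    ext i j
    fin_cases i <;> fin_cases j <;> simp [Fin.snoc, h2]
  rw [hmat, conormal_apply, ← abs_neg]
  congr 1
  simp [Matrix.det_succ_row_zero, Fin.sum_univ_succ, Fin.succAbove]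
  ring

/-! ### The affine normal depends on t alone. -/

variable {p : Fin 3 → ℝ}

theorem abs_conormal_pow (H : IsTranslationHypersurface N f I γ ξ)
    (hq : q ∈ translationDomain I N) :
    |conormal f γ q (ξ q)| ^ 5 = |wronskian γ (q 0) * vel γ 0 (q 0) ^ 2| := by
  have h := H.posDef.volume_eq q hq
  have hne : |conormal f γ q (ξ q)| ≠ 0 := abs_ne_zero.2 (H.conormal_normal_ne_zero hq)
  rw [H.inducedVolume_eq hq, H.det_metricMatrix hq, abs_div, abs_pow] at h
  have h2 := congrArg (· ^ 2) h
  rw [Real.sq_sqrt (by positivity), eq_div_iff (by positivity)] at h2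
  rw [← h2]; ring

/-- The fifth power fixes |μ| in terms of t, and positivity of W/μ fixes the sign. -/
theorem conormal_normal_congr (H : IsTranslationHypersurface N f I γ ξ)
    (hp : p ∈ translationDomain I N) (hq : q ∈ translationDomain I N) (h : p 0 = q 0) :
    conormal f γ p (ξ p) = conormal f γ q (ξ q) := by
  have habs : |conormal f γ p (ξ p)| = |conormal f γ q (ξ q)| := by
    refine (pow_left_inj₀ (abs_nonneg _) (abs_nonneg _) (by norm_num : 5 ≠ 0)).1 ?_
    rw [H.abs_conormal_pow hp, H.abs_conormal_pow hq, h]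
  rcases abs_eq_abs.1 habs with h' | h'
  · exact h'
  · have h1 := H.wronskian_div_pos hp
    have h2 := H.wronskian_div_pos hq
    rw [h, h', div_neg] at h1
    linarith

theorem wronskian_ne_zero (H : IsTranslationHypersurface N f I γ ξ)
    (hq : q ∈ translationDomain I N) : wronskian γ (q 0) ≠ 0 := fun h => by
  have := H.wronskian_div_pos hq
  simp [h] at this

theorem vel_ne_zero (H : IsTranslationHypersurface N f I γ ξ)
    (hq : q ∈ translationDomain I N) : vel γ 0 (q 0) ≠ 0 := fun h => by
  have := H.vel_mul_hessCoeff_pos hq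
  simp [h] at this

theorem hasFDerivAt_normal (H : IsTranslationHypersurface N f I γ ξ)
    (hq : q ∈ translationDomain I N) : HasFDerivAt ξ (fderiv ℝ ξ q) q :=
  (H.posDef.contDiffOn_normal.differentiableAt_of_isOpen H.isOpen_domain hq).hasFDerivAt

/-- In the product rule for ν(ξ) the term ν(D_X ξ) vanishes because D_X ξ is tangential; only the
derivative of ν remains. -/
theorem hasFDerivAt_conormal_normal (H : IsTranslationHypersurface N f I γ ξ)
    (hq : q ∈ translationDomain I N) :
    ∃ L : (Fin 3 → ℝ) →L[ℝ] ℝ, HasFDerivAt (fun q => conormal f γ q (ξ q)) L q ∧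
      ∀ X, L X = X 0 * (acc γ 0 (q 0) * (ξ q 2
          - (fderiv ℝ f (baseProj q) (Pi.single 0 1) * ξ q 0
            + fderiv ℝ f (baseProj q) (Pi.single 1 1) * ξ q 1)) - acc γ 1 (q 0) * ξ q 3)
        - vel γ 0 (q 0) * (hess f (baseProj q) (baseProj X) (Pi.single 0 1) * ξ q 0
          + hess f (baseProj q) (baseProj X) (Pi.single 1 1) * ξ q 1) := by
  have hξ : ∀ i, HasFDerivAt (fun q => ξ q i) _ q := hasFDerivAt_pi'.1 (H.hasFDerivAt_normal hq)
  have hv := fun i => hasFDerivAt_comp_first H.isOpen_interval (H.contDiffOn_vel i) hq.1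
  have hf := fun Y => hasFDerivAt_comp_baseProj H.isOpen_base
    (contDiffOn_fderiv_apply H.isOpen_base H.contDiffOn_graph Y) hq.2
  have hD := ((hv 0).fun_mul ((hξ 2).fun_sub (((hf (Pi.single 0 1)).fun_mul (hξ 0)).fun_add
    ((hf (Pi.single 1 1)).fun_mul (hξ 1))))).fun_sub ((hv 1).fun_mul (hξ 3))
  refine ⟨_, by simpa only [conormal_apply] using hD, fun X => ?_⟩
  have he := map_eq_transversalPart_mul (H.posDef.transversal q hq) _ (H.conormal_fderiv hq)
    (fderiv ℝ ξ q X)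
  rw [H.posDef.equiaffine q hq, zero_mul, conormal_apply] at he
  simp [acc, hess]
  linear_combination he

theorem differentiableAt_conormal_normal (H : IsTranslationHypersurface N f I γ ξ)
    (hq : q ∈ translationDomain I N) :
    DifferentiableAt ℝ (fun q => conormal f γ q (ξ q)) q :=
  let ⟨_, h, _⟩ := H.hasFDerivAt_conormal_normal hq
  h.differentiableAt

/-- The affine normal lies in the plane spanned by the last two coordinate directions. -/
theorem normal_base_eq_zero (H : IsTranslationHypersurface N f I γ ξ)
    (hq : q ∈ translationDomain I N) : ξ q 0 = 0 ∧ ξ q 1 = 0 := by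
  obtain ⟨L, hL, hLX⟩ := H.hasFDerivAt_conormal_normal hq
  have h0 : ∀ X : Fin 3 → ℝ, X 0 = 0 → L X = 0 := fun X hX => by
    rw [← hL.fderiv, fderiv_of_eq_of_first_eq H.isOpen_domain
      (fun _ h₁ _ h₂ => H.conormal_normal_congr h₁ h₂) hq hL.differentiableAt, hX, zero_smul]
  have hv := H.vel_ne_zero hq
  have hd := H.det_hess_eq_one hq
  have h1 := (hLX _).symm.trans (h0 (Pi.single 1 1) (by simp))
  have h2 := (hLX _).symm.trans (h0 (Pi.single 2 1) (by simp))
  simp only [hess_fin_two H.isOpen_base H.contDiffOn_graph hq.2] at h1 h2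
  simp [hv] at h1 h2
  -- Here `h1` and `h2` say that Hess f annihilates (ξ₀, ξ₁); Cramer's rule with determinant 1
  -- finishes.
  constructor
  · linear_combination -ξ q 0 * hd + hessCoeff f 1 1 (baseProj q) * h1
      - hessCoeff f 0 1 (baseProj q) * h2
  · linear_combination -ξ q 1 * hd + hessCoeff f 0 0 (baseProj q) * h2
      - hessCoeff f 0 1 (baseProj q) * h1

/-- μ and its t-derivative are two linear equations for (ξ₂, ξ₃), with coefficients depending on t
and determinant -W ≠ 0. -/
theorem normal_congr (H : IsTranslationHypersurface N f I γ ξ)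
    (hp : p ∈ translationDomain I N) (hq : q ∈ translationDomain I N) (h : p 0 = q 0) :
    ξ p = ξ q := by
  have hμ := H.conormal_normal_congr hp hq h
  obtain ⟨hp0, hp1⟩ := H.normal_base_eq_zero hp
  obtain ⟨hq0, hq1⟩ := H.normal_base_eq_zero hq
  have hd := fderiv_first_congr H.isOpen_domain
      (fun _ h₁ _ h₂ => H.conormal_normal_congr h₁ h₂) hp hq h
      (H.differentiableAt_conormal_normal hp) (H.differentiableAt_conormal_normal hq)
  obtain ⟨L, hL, hLX⟩ := H.hasFDerivAt_conormal_normal hp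
  obtain ⟨L', hL', hLX'⟩ := H.hasFDerivAt_conormal_normal hq
  rw [hL.fderiv, hL'.fderiv, hLX, hLX', hp0, hp1, hq0, hq1, h] at hd
  rw [conormal_apply, conormal_apply, hp0, hp1, hq0, hq1, h] at hμ
  simp at hd hμ
  have hW := H.wronskian_ne_zero hq
  have h2 : ξ p 2 = ξ q 2 := by
    apply mul_left_cancel₀ hW
    simp only [wronskian]
    linear_combination acc γ 1 (q 0) * hμ - vel γ 1 (q 0) * hd
  have h3 : ξ p 3 = ξ q 3 := by
    apply mul_left_cancel₀ hW
    simp only [wronskian]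
    linear_combination acc γ 0 (q 0) * hμ - vel γ 0 (q 0) * hd
  ext i
  fin_cases i
  · exact hp0.trans hq0.symm
  · exact hp1.trans hq1.symm
  · exact h2
  · exact h3

/-- The first two components of dF X are X₁, X₂, and those of ξ vanish. Applied to D_X Y and D_X ξ,
this makes ∇_X Y and SX multiples of ∂_t. -/
theorem tangentialPart_eq_single (H : IsTranslationHypersurface N f I γ ξ)
    (hq : q ∈ translationDomain I N) {w : Fin 4 → ℝ} (h0 : w 0 = 0) (h1 : w 1 = 0) :
    tangentialPart (translationImmersion f γ) ξ q w
      = Pi.single 0 (tangentialPart (translationImmersion f γ) ξ q w 0) := by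
  have h := fderiv_tangentialPart_add (H.posDef.transversal q hq) w
  rw [H.fderiv_immersion hq] at h
  obtain ⟨hq0, hq1⟩ := H.normal_base_eq_zero hq
  have e0 := congrFun h 0
  have e1 := congrFun h 1
  simp [hq0, hq1, h0, h1] at e0 e1
  ext i
  fin_cases i
  · simp
  · simpa using e0
  · simpa using e1

theorem fderiv_normal_base (H : IsTranslationHypersurface N f I γ ξ)
    (hq : q ∈ translationDomain I N) (X : Fin 3 → ℝ) :
    fderiv ℝ ξ q X 0 = 0 ∧ fderiv ℝ ξ q X 1 = 0 := by
  have key : ∀ i : Fin 4, (∀ p ∈ translationDomain I N, ξ p i = 0) → fderiv ℝ ξ q X i = 0 := by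
    intro i hi
    have h1 := hasFDerivAt_pi'.1 (H.hasFDerivAt_normal hq) i
    have h2 : (fun p => ξ p i) =ᶠ[𝓝 q] fun _ => 0 := by
      filter_upwards [H.isOpen_domain.mem_nhds hq] with p hp using hi p hp
    exact DFunLike.congr_fun (h1.unique ((hasFDerivAt_const (0 : ℝ) q).congr_of_eventuallyEq h2)) X
  exact ⟨key 0 fun p hp => (H.normal_base_eq_zero hp).1,
    key 1 fun p hp => (H.normal_base_eq_zero hp).2⟩

/-! ### Invariance of h, S and K under the rotation. -/

/-- The rotation by `2π/3` about the `t`-axis with respect to the Hessian of `f`. -/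
def rot (f : (Fin 2 → ℝ) → ℝ) (q : Fin 3 → ℝ) : Matrix (Fin 3) (Fin 3) ℝ :=
  rotThird (hessCoeff f 0 0 (baseProj q)) (hessCoeff f 0 1 (baseProj q))
    (hessCoeff f 1 1 (baseProj q))

theorem hess_rot (H : IsTranslationHypersurface N f I γ ξ)
    (hq : q ∈ translationDomain I N) (X Y : Fin 3 → ℝ) :
    hess f (baseProj q) (baseProj ((rot f q).mulVec X)) (baseProj ((rot f q).mulVec Y))
      = hess f (baseProj q) (baseProj X) (baseProj Y) := by
  rw [hess_fin_two H.isOpen_base H.contDiffOn_graph hq.2,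
    hess_fin_two H.isOpen_base H.contDiffOn_graph hq.2]
  exact rotThird_quadratic (H.det_hess_eq_one hq) X Y

theorem rot_mulVec_zero (X : Fin 3 → ℝ) : (rot f q).mulVec X 0 = X 0 :=
  rotThird_mulVec_zero X

theorem secondDeriv_rot (H : IsTranslationHypersurface N f I γ ξ)
    (hq : q ∈ translationDomain I N) (X Y : Fin 3 → ℝ) :
    secondDeriv (translationImmersion f γ) q ((rot f q).mulVec X) ((rot f q).mulVec Y)
      = secondDeriv (translationImmersion f γ) q X Y := by
  rw [H.secondDeriv_immersion hq, H.secondDeriv_immersion hq, H.hess_rot hq, rot_mulVec_zero,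
    rot_mulVec_zero]

theorem affineMetric_rot (H : IsTranslationHypersurface N f I γ ξ)
    (hq : q ∈ translationDomain I N) (X Y : Fin 3 → ℝ) :
    affineMetric (translationImmersion f γ) ξ q ((rot f q).mulVec X) ((rot f q).mulVec Y)
      = affineMetric (translationImmersion f γ) ξ q X Y := by
  rw [affineMetric, H.secondDeriv_rot hq, affineMetric]

theorem inducedConnection_rot (H : IsTranslationHypersurface N f I γ ξ)
    (hq : q ∈ translationDomain I N) (X Y : Fin 3 → ℝ) :
    inducedConnection (translationImmersion f γ) ξ q ((rot f q).mulVec X) ((rot f q).mulVec Y)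
      = (rot f q).mulVec (inducedConnection (translationImmersion f γ) ξ q X Y) := by
  rw [inducedConnection, H.secondDeriv_rot hq, inducedConnection]
  have h0 : secondDeriv (translationImmersion f γ) q X Y 0 = 0 := by
    rw [H.secondDeriv_immersion hq]; rfl
  have h1 : secondDeriv (translationImmersion f γ) q X Y 1 = 0 := by
    rw [H.secondDeriv_immersion hq]; rfl
  rw [H.tangentialPart_eq_single hq h0 h1]
  exact (rotThird_mulVec_single_zero _).symm

theorem shapeOperator_rot (H : IsTranslationHypersurface N f I γ ξ)
    (hq : q ∈ translationDomain I N) (X : Fin 3 → ℝ) :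
    shapeOperator (translationImmersion f γ) ξ q ((rot f q).mulVec X)
      = (rot f q).mulVec (shapeOperator (translationImmersion f γ) ξ q X) := by
  have h : fderiv ℝ ξ q ((rot f q).mulVec X) = fderiv ℝ ξ q X := by
    have h' := fun Y => fderiv_of_eq_of_first_eq H.isOpen_domain
      (fun _ h₁ _ h₂ => H.normal_congr h₁ h₂) hq (H.hasFDerivAt_normal hq).differentiableAt Y
    rw [h', rot_mulVec_zero, ← h']
  obtain ⟨h0, h1⟩ := H.fderiv_normal_base hq X
  rw [shapeOperator, h, shapeOperator, Matrix.mulVec_neg, H.tangentialPart_eq_single hq h0 h1]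
  exact congrArg Neg.neg (rotThird_mulVec_single_zero _).symm

/-- The first derivatives of the affine metric. -/
theorem exists_fderiv_affineMetric (H : IsTranslationHypersurface N f I γ ξ)
    (hq : q ∈ translationDomain I N) :
    ∃ m c : ℝ, ∀ X Y Z, fderiv ℝ (fun p => affineMetric (translationImmersion f γ) ξ p Y Z) q X
      = m * (X 0 * Y 0 * Z 0) + c * X 0 * hess f (baseProj q) (baseProj Y) (baseProj Z)
        + vel γ 0 (q 0) / conormal f γ q (ξ q)
          * fderiv ℝ (fun x => hess f x (baseProj Y) (baseProj Z)) (baseProj q) (baseProj X) := by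
  have hv := fun i =>
    (hasFDerivAt_comp_first H.isOpen_interval (H.contDiffOn_vel i) hq.1).differentiableAt
  have ha := fun i =>
    (hasFDerivAt_comp_first H.isOpen_interval (H.contDiffOn_acc i) hq.1).differentiableAt
  have hμ := H.differentiableAt_conormal_normal hq
  have hne := H.conormal_normal_ne_zero hq
  have hW : DifferentiableAt ℝ (fun p : Fin 3 → ℝ => wronskian γ (p 0)) q :=
    ((hv 0).fun_mul (ha 1)).fun_sub ((hv 1).fun_mul (ha 0))
  have hm : DifferentiableAt ℝ (fun p => wronskian γ (p 0) / conormal f γ p (ξ p)) q :=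
    by simpa only [div_eq_mul_inv] using hW.fun_mul (hμ.fun_inv hne)
  have hc : DifferentiableAt ℝ (fun p => vel γ 0 (p 0) / conormal f γ p (ξ p)) q :=
    by simpa only [div_eq_mul_inv] using (hv 0).fun_mul (hμ.fun_inv hne)
  -- The witnesses are the t-derivatives of the coefficients W/μ and γ₁'/μ of h.
  refine ⟨fderiv ℝ (fun p => wronskian γ (p 0) / conormal f γ p (ξ p)) q (Pi.single 0 1),
    fderiv ℝ (fun p => vel γ 0 (p 0) / conormal f γ p (ξ p)) q (Pi.single 0 1), fun X Y Z => ?_⟩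
  have he : (fun p => affineMetric (translationImmersion f γ) ξ p Y Z) =ᶠ[𝓝 q] fun p =>
      wronskian γ (p 0) / conormal f γ p (ξ p) * (Y 0 * Z 0)
        + vel γ 0 (p 0) / conormal f γ p (ξ p)
          * hess f (baseProj p) (baseProj Y) (baseProj Z) := by
    filter_upwards [H.isOpen_domain.mem_nhds hq] with p hp using H.affineMetric_eq hp Y Z
  have hh := hasFDerivAt_comp_baseProj H.isOpen_base
    (contDiffOn_hess H.isOpen_base H.contDiffOn_graph (baseProj Y) (baseProj Z)) hq.2
  have hmX := fderiv_of_eq_of_first_eq H.isOpen_domain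
    (fun _ h₁ _ h₂ h => by rw [H.conormal_normal_congr h₁ h₂ h, h]) hq hm X
  have hcX := fderiv_of_eq_of_first_eq H.isOpen_domain
    (fun _ h₁ _ h₂ h => by rw [H.conormal_normal_congr h₁ h₂ h, h]) hq hc X
  rw [he.fderiv_eq, ((hm.hasFDerivAt.mul_const _).fun_add (hc.hasFDerivAt.fun_mul hh)).fderiv]
  simp only [add_apply, smul_apply, hmX, hcX,
    ContinuousLinearMap.comp_apply, smul_eq_mul]
  ring

theorem leviCivita_rot (H : IsTranslationHypersurface N f I γ ξ)
    (hq : q ∈ translationDomain I N) (X Y : Fin 3 → ℝ) :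
    leviCivita (translationImmersion f γ) ξ q ((rot f q).mulVec X) ((rot f q).mulVec Y)
      = (rot f q).mulVec (leviCivita (translationImmersion f γ) ξ q X Y) := by
  obtain ⟨m, c, hmc⟩ := H.exists_fderiv_affineMetric hq
  obtain ⟨a₀, a₁, a₂, a₃, ha, hap₁, hap₂⟩ :=
    exists_cubic H.isOpen_base H.contDiffOn_graph H.abs_det hq.2
  have hdet := H.det_hess_eq_one hq
  have hcub : ∀ X Y Z : Fin 3 → ℝ,
      fderiv ℝ (fun x => hess f x (baseProj Y) (baseProj Z)) (baseProj q) (baseProj X)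
        = cubicForm a₀ a₁ a₂ a₃ X Y Z := fun X Y Z => ha _ _ _
  have hquad := H.hess_rot hq
  have hcoord := fun X Y : Fin 3 → ℝ =>
    hess_fin_two H.isOpen_base H.contDiffOn_graph hq.2 (baseProj X) (baseProj Y)
  have hR3 : rot f q ^ 3 = 1 := rotThird_pow_three hdet
  -- The Koszul form is built from dt, Hess f and the apolar cubic, all invariant. The m-terms and
  -- the cubic terms are symmetric, so the signs +, +, - leave one copy of each.
  refine leviCivita_mulVec _ _ _ _ ?_ ?_ (fun X Y Z => (1 / 2 : ℝ) * (m * (X 0 * Y 0 * Z 0)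
      + c * (X 0 * hess f (baseProj q) (baseProj Y) (baseProj Z)
        + Y 0 * hess f (baseProj q) (baseProj X) (baseProj Z)
        - Z 0 * hess f (baseProj q) (baseProj X) (baseProj Y))
      + vel γ 0 (q 0) / conormal f γ q (ξ q) * cubicForm a₀ a₁ a₂ a₃ X Y Z)) ?_ ?_ ?_ ?_
      (H.affineMetric_rot hq) X Y
  · rw [isUnit_iff_ne_zero]
    intro h
    have := congrArg Matrix.det hR3
    rw [Matrix.det_pow, h] at this
    simp at this
  · rw [isUnit_iff_ne_zero, H.det_metricMatrix hq]
    exact div_ne_zero (mul_ne_zero (H.wronskian_ne_zero hq) (pow_ne_zero _ (H.vel_ne_zero hq)))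
      (pow_ne_zero _ (H.conormal_normal_ne_zero hq))
  · intro X Y Z
    simp only [Fin.sum_univ_three, hcoord, cubicForm]
    simp
    ring
  · intro X Y l
    rw [hmc, hmc, hmc, hcub, hcub, hcub, cubicForm_comm_left _ _ _ _ Y X,
      cubicForm_comm_left _ _ _ _ (Pi.single l 1), cubicForm_comm_right _ _ _ _ X (Pi.single l 1)]
    ring
  · intro X Y Z
    simp only [hquad, rot_mulVec_zero]
    rw [rot, cubicForm_rotThird hdet hap₁ hap₂]
  · intro X Y
    simp only [Fin.sum_univ_three, H.affineMetric_coord hq]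
    simp
    ring

theorem admitsPointwiseSymmetry_Z3 (H : IsTranslationHypersurface N f I γ ξ) :
    AdmitsPointwiseSymmetry Z3 (translationImmersion f γ) ξ (translationDomain I N) := by
  intro q hq
  refine exists_Z3_hom _ _ _ (rot f q) (rotThird_pow_three (H.det_hess_eq_one hq))
    rotThird_ne_one (H.affineMetric_rot hq) (fun X Y => ?_) (H.shapeOperator_rot hq)
  rw [differenceTensor, H.inducedConnection_rot hq, H.leviCivita_rot hq, differenceTensor,
    Matrix.mulVec_sub]

end IsTranslationHypersurface

end

end AffineHypersurface

open AffineHypersurface in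
theorem theorem4p6
    (N : Set (Fin 2 → ℝ)) (hN : IsOpen N) (f : (Fin 2 → ℝ) → ℝ)
    (hψ : IsImproperAffineSphere (fun x => ![x 0, x 1, f x]) (fun _ => ![0, 0, 1]) N)
    (I : Set ℝ) (hI : IsOpen I) (hI' : I.OrdConnected)
    (γ : ℝ → Fin 2 → ℝ) (hγ : ContDiffOn ℝ ∞ γ I)
    (F : (Fin 3 → ℝ) → (Fin 4 → ℝ))
    (hF : F = fun p => ![p 1, p 2, f ![p 1, p 2] + γ (p 0) 1, γ (p 0) 0])
    (U : Set (Fin 3 → ℝ)) (hU : U = {p | p 0 ∈ I ∧ ![p 1, p 2] ∈ N})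
    (ξ : (Fin 3 → ℝ) → (Fin 4 → ℝ)) (hξ : IsPositiveDefinite F ξ U) :
    AdmitsPointwiseSymmetry Z3 F ξ U ∨ AdmitsPointwiseSymmetry SO2 F ξ U := by
  have hF' : F = translationImmersion f γ := by
    rw [hF]; funext p; simp only [translationImmersion, baseProj_apply]
  have hU' : U = translationDomain I N := by
    rw [hU]; ext p; simp only [translationDomain, baseProj_apply]
  have hf : ContDiffOn ℝ ∞ f N := contDiffOn_pi.1 hψ.contDiffOn_immersion 2
  subst hF' hU'
  exact Or.inl (IsTranslationHypersurface.admitsPointwiseSymmetry_Z3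
    ⟨hN, hf, fun _ hx => hψ.abs_det_hess hN hf hx, hI, hγ, hξ⟩)
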